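/- Let $\mathcal R$ be the Levi-Civita field: the functions $x:\mathbb Q\to\mathbb R$ whose support is left-finite (finitely many elements below every bound), with pointwise sum, convolution product, and $x<y$ iff $x(q)<y(q)$ at the least $q$ with $x(q)\neq y(q)$. Let $\mathcal R_{fin}=\{x\in\mathcal R:\exists s\in\mathbb R,\ |x|<s\}$, and for $x\in\mathcal R$ let ${}^\circ x=\sup\{z\in\mathbb R: z\le x\}\in[-\infty,+\infty]$ be its standard part. *Non-Archimedean measure and integral.* Intervals are bounded (possibly degenerate), with or without endpoints, and $l$ is their length. A set $A\subseteq\mathcal R$ is measurable if for every $\varepsilon>0$ in $\mathcal R$ there are sequences of mutually disjoint intervals $(I_n)$, $(J_n)$ with $\bigcup I_n\subseteq A\subseteq\bigcup J_n$ whose total lengths converge in the order topology and differ by at most $\varepsilon$; its measure $m(A)$ is the supremum of the total lengths of such inner sequences, which is the infimum of the total lengths of such outer sequences. A sequence $(c_k)$ in $\mathcal R$ converges weakly to $l$ if for every real $\varepsilon>0$ one has, for all large $k$, $|(c_k-l)(q)|<\varepsilon$ for every rational $q\le\varepsilon^{-1}$. A function is simple on an interval if there it is the weak sum of a power series $\sum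 a_n(x-x_0)^n$ with $a_n,x_0\in\mathcal R$; its integral over an interval with endpoints $a<b$ is $\lim_{x\to b}F-\lim_{x\to a}F$, with $F$ a simple antiderivative (and $0$ over a degenerate interval). A function $f:A\to\mathcal R$ on a measurable set $A$ is measurable if for every $\varepsilon>0$ in $\mathcal R$ there are mutually disjoint intervals $I_n\subseteq A$ with $\sum l(I_n)$ convergent, $m(A)-\sum l(I_n)<\varepsilon$ and $f$ simple on each $I_n$; then $\int_A f$ is the limit, if it exists, of $\sum_n\int_{I_n}f$ over the sequences of disjoint intervals $I_n\subseteq A$ on which $f$ is simple, as $\sum l(I_n)\to m(A)$. $\mathcal L^1(A)$ is the set of measurable $f$ for which $\int_A|f|$ is defined in $\mathcal R$. *M-integral.* Let $A$ be measurable, $f:A\to\mathcal R$. Put $L(f)=\sup\{{}^\circ(\int_A g): g\in\mathcal L^1(A),\ g\le f \text{ on } A\}$ and $U(f)=\inf\{{}^\circ(\int_A g): g\in\mathcal L^1(A),\ g\ge f\text{ on }A\}$ in $[-\infty,+\infty]$. If $f$ is bounded (by an element of $\mathcal R$), $f$ is M-integrable iff $L(f)=U(f)$, and then $\int^M_A f=L(f)$.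 If $f$ is unbounded and non-negative, $f$ is M-integrable iff $L(f)<+\infty$, and then $\int_A^M f=L(f)$. If $f$ is unbounded and non-positive, it is M-integrable iff $f^-$ is, with $\int^M_A f=-\int^M_A f^-$. Any other unbounded $f$ is M-integrable iff $f^+$ and $f^-$ are, with $\int_A^M f=\int_A^M f^+-\int_A^M f^-$. A function $f:\mathcal R_{fin}\to\mathcal R$ is M-integrable if it is M-integrable on $[-t,t]_{\mathcal R}$ for all large real $t$ and $\lim_{t\to+\infty}\int^M_{[-t,t]_{\mathcal R}}f$ exists finite in $\mathbb R$; this limit is $\int^M_{\mathcal R_{fin}}f$. *Dirac-like functions.* An M-integrable function $\delta_r:\mathcal R_{fin}\to\mathcal R$ is Dirac-like at $r\in\mathcal R_{fin}$ if $\delta_r(x)\ge 0$ for all $x\in\mathcal R_{fin}$, there is an infinitesimal $h>0$ such that $\operatorname{supp}\delta_r\subseteq[r-h,r+h]_{\mathcal R}\subseteq\mathcal R_{fin}$, and $\int^M_{\mathcal R_{fin}}\delta_r=1$. For a continuous $f:\mathbb R\to\mathbb R$, let $\mathrm{ext}_0 f:\mathcal R_{fin}\to\mathcal R$ be defined by $\mathrm{ext}_0f(s+\varepsilon)=f(s)$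 for $s\in\mathbb R$ and $\varepsilon$ infinitesimal (possibly zero). **Proposition.** Let $r\in\mathbb R$. For every M-integrable function $\delta_r:\mathcal R_{fin}\to\mathcal R$ that is Dirac-like at $r$ and every $f\in C^0(\mathbb R)$, the function $\delta_r\cdot\mathrm{ext}_0 f$ is M-integrable over $\mathcal R_{fin}$ and $$\int^M_{\mathcal R_{fin}}\bigl(\delta_r\cdot\mathrm{ext}_0f\bigr)=f(r).$$ -/

import Mathlib

open Filter Topology

noncomputable section

/-! ### The Levi-Civita field -/

/-- A set of rational numbers is left-finite if it has finitely many elements below every bound. -/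
def IsLeftFinite (S : Set ℚ) : Prop := ∀ q : ℚ, (S ∩ Set.Iic q).Finite

theorem IsLeftFinite.mono {S T : Set ℚ} (hT : IsLeftFinite T) (h : S ⊆ T) : IsLeftFinite S :=
  fun q => (hT q).subset (Set.inter_subset_inter_left _ h)

theorem IsLeftFinite.union {S T : Set ℚ} (hS : IsLeftFinite S) (hT : IsLeftFinite T) :
    IsLeftFinite (S ∪ T) := fun q => by
  rw [Set.union_inter_distrib_right]
  exact (hS q).union (hT q)

theorem isLeftFinite_singleton (a : ℚ) : IsLeftFinite {a} :=
  fun _ => (Set.finite_singleton a).subset Set.inter_subset_left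

theorem IsLeftFinite.bddBelow {S : Set ℚ} (hS : IsLeftFinite S) : BddBelow S := by
  obtain ⟨b, hb⟩ := (hS 0).bddBelow
  refine ⟨min b 0, fun s hs => ?_⟩
  rcases le_total s 0 with h | h
  · exact (min_le_left _ _).trans (hb ⟨hs, h⟩)
  · exact (min_le_right _ _).trans h

open scoped Pointwise in
theorem IsLeftFinite.add {S T : Set ℚ} (hS : IsLeftFinite S) (hT : IsLeftFinite T) :
    IsLeftFinite (S + T) := by
  intro q
  obtain ⟨a, ha⟩ := hS.bddBelow
  obtain ⟨b, hb⟩ := hT.bddBelow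
  refine ((hS (q - b)).add (hT (q - a))).subset ?_
  rintro _ ⟨⟨s, hs, t, ht, rfl⟩, hq⟩
  have h1 := ha hs
  have h2 := hb ht
  have h3 : s + t ≤ q := hq
  refine ⟨s, ⟨hs, ?_⟩, t, ⟨ht, ?_⟩, rfl⟩ <;> simp only [Set.mem_Iic] <;> linarith

/-- The functions `ℚ → ℝ` with left-finite support, inside the Hahn series (the functions `ℚ → ℝ`
with well-ordered support), with pointwise sum and convolution product. -/
def leviCivitaSubring : Subring (HahnSeries ℚ ℝ) where
  carrier := {x | IsLeftFinite x.support}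
  mul_mem' {x y} hx hy :=
    (IsLeftFinite.add hx hy).mono HahnSeries.support_mul_subset
  one_mem' := (isLeftFinite_singleton 0).mono HahnSeries.support_single_subset
  add_mem' {x y} hx hy := (IsLeftFinite.union hx hy).mono (HahnSeries.support_add_subset _ _)
  zero_mem' := fun q => by simp
  neg_mem' {x} hx := by
    change IsLeftFinite (HahnSeries.support (-x))
    rw [HahnSeries.support_neg]
    exact hx

/-- The Levi-Civita field. -/
def LeviCivita : Type := leviCivitaSubring

namespace LeviCivita

instance : CommRing LeviCivita := inferInstanceAs (CommRing leviCivitaSubring)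

/-- The value `x(q)` of the function `x : ℚ → ℝ`. -/
def coeff (x : LeviCivita) (q : ℚ) : ℝ := HahnSeries.coeff x.1 q

/-- The order of the Levi-Civita field: `x < y` iff `x(q) < y(q)` at the least `q` with
`x(q) ≠ y(q)`. -/
instance : LinearOrder LeviCivita :=
  LinearOrder.lift' (fun x : LeviCivita => (toLex x.1 : Lex (HahnSeries ℚ ℝ)))
    (fun _ _ h => Subtype.ext (toLex.injective h))

theorem lt_iff (x y : LeviCivita) :
    x < y ↔ ∃ q : ℚ, (∀ p < q, x.coeff p = y.coeff p) ∧ x.coeff q < y.coeff q := Iff.rfl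

/-- The embedding of the real numbers. -/
def ofReal : ℝ →+* LeviCivita :=
  RingHom.codRestrict (HahnSeries.C : ℝ →+* HahnSeries ℚ ℝ) leviCivitaSubring
    (fun _ => (isLeftFinite_singleton 0).mono HahnSeries.support_single_subset)

/-- The finite elements. -/
def finiteSet : Set LeviCivita := {x | ∃ r : ℝ, |x| < ofReal r}

/-- Infinitesimal elements (zero included). -/
def IsInfinitesimal (x : LeviCivita) : Prop := ∀ r : ℝ, 0 < r → |x| ≤ ofReal r

/-- The standard part `sup {z ∈ ℝ : z ≤ x}`; it is `+∞` at positive infinite elements and `-∞` at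
negative infinite elements. -/
def sh (x : LeviCivita) : EReal := sSup {z : EReal | ∃ r : ℝ, z = (r : EReal) ∧ ofReal r ≤ x}

/-! ### Convergence, power series, simple functions -/

/-- The series `∑ a n` strongly converges (in the order topology) to `s`. -/
def HasStrongSum (a : ℕ → LeviCivita) (s : LeviCivita) : Prop :=
  ∀ ε : LeviCivita, 0 < ε → ∃ n : ℕ, ∀ m > n, |(∑ i ∈ Finset.range (m + 1), a i) - s| < ε

/-- Weak convergence of a sequence. -/
def WeakLim (c : ℕ → LeviCivita) (l : LeviCivita) : Prop :=
  ∀ ε : ℝ, 0 < ε → ∃ n : ℕ, ∀ m > n, ∀ q : ℚ, (q : ℝ) ≤ ε⁻¹ → |(c m - l).coeff q| < ε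

/-- `f` is simple on `S`: there it is the (weak) sum of a power series that weakly converges at
every point of `S`. -/
def IsSimpleOn (f : LeviCivita → LeviCivita) (S : Set LeviCivita) : Prop :=
  ∃ (a : ℕ → LeviCivita) (x₀ : LeviCivita), ∀ x ∈ S,
    WeakLim (fun k => ∑ n ∈ Finset.range (k + 1), a n * (x - x₀) ^ n) (f x)

/-- A bounded interval, with or without its endpoints `left ≤ right`. -/
structure BddInterval where
  left : LeviCivita
  right : LeviCivita
  left_le_right : left ≤ right
  toSet : Set LeviCivita
  toSet_eq : toSet = Set.Icc left right ∨ toSet = Set.Ico left right ∨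
    toSet = Set.Ioc left right ∨ toSet = Set.Ioo left right

/-- The length of an interval. -/
def BddInterval.length (I : BddInterval) : LeviCivita := I.right - I.left

/-- `F` has derivative `f` on `S`. -/
def HasDerivOn (F f : LeviCivita → LeviCivita) (S : Set LeviCivita) : Prop :=
  ∀ x ∈ S, ∀ ε : LeviCivita, 0 < ε → ∃ η : LeviCivita, 0 < η ∧
    ∀ y ∈ S, |y - x| < η → |F y - F x - f x * (y - x)| ≤ ε * |y - x|

/-- `F y` tends to `l` as `y → x`, `y ∈ S`. -/
def HasLimWithin (F : LeviCivita → LeviCivita) (S : Set LeviCivita) (x l : LeviCivita) : Prop :=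
  ∀ ε : LeviCivita, 0 < ε → ∃ η : LeviCivita, 0 < η ∧ ∀ y ∈ S, |y - x| < η → |F y - l| < ε

/-- The function `f`, simple on `I`, has integral `v` over `I`: `v` is the difference of the limits
at the endpoints of a simple antiderivative. The integral over a degenerate interval is zero. -/
def HasSimpleIntegral (I : BddInterval) (f : LeviCivita → LeviCivita) (v : LeviCivita) : Prop :=
  (I.left = I.right ∧ v = 0) ∨
  (I.left < I.right ∧ ∃ (F : LeviCivita → LeviCivita) (la lb : LeviCivita),
    IsSimpleOn F I.toSet ∧ HasDerivOn F f I.toSet ∧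
    HasLimWithin F I.toSet I.left la ∧ HasLimWithin F I.toSet I.right lb ∧ v = lb - la)

/-! ### The non-Archimedean uniform measure and integral -/

/-- The intervals `I n` are mutually disjoint and contained in `A`. -/
def InnerFamily (A : Set LeviCivita) (I : ℕ → BddInterval) : Prop :=
  Pairwise (fun i j => Disjoint (I i).toSet (I j).toSet) ∧ (⋃ n, (I n).toSet) ⊆ A

/-- The intervals `J n` are mutually disjoint and cover `A`. -/
def OuterFamily (A : Set LeviCivita) (J : ℕ → BddInterval) : Prop :=
  Pairwise (fun i j => Disjoint (J i).toSet (J j).toSet) ∧ A ⊆ ⋃ n, (J n).toSet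

/-- Measurable sets. -/
def IsMeasurableSet (A : Set LeviCivita) : Prop :=
  ∀ ε : LeviCivita, 0 < ε → ∃ (I J : ℕ → BddInterval) (s t : LeviCivita),
    InnerFamily A I ∧ OuterFamily A J ∧
    HasStrongSum (fun n => (I n).length) s ∧ HasStrongSum (fun n => (J n).length) t ∧ t - s ≤ ε

/-- The measurable set `A` has measure `m`. -/
def HasMeasure (A : Set LeviCivita) (m : LeviCivita) : Prop :=
  IsMeasurableSet A ∧
  IsLUB {s | ∃ I, InnerFamily A I ∧ HasStrongSum (fun n => (I n).length) s} m ∧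
  IsGLB {t | ∃ J, OuterFamily A J ∧ HasStrongSum (fun n => (J n).length) t} m

/-- `f` is a measurable function on the measurable set `A`. (Here and below only the values of `f`
on `A` matter.) -/
def IsMeasurableFun (A : Set LeviCivita) (f : LeviCivita → LeviCivita) : Prop :=
  ∃ m, HasMeasure A m ∧ ∀ ε : LeviCivita, 0 < ε → ∃ (I : ℕ → BddInterval) (s : LeviCivita),
    InnerFamily A I ∧ HasStrongSum (fun n => (I n).length) s ∧ m - s < ε ∧
    ∀ n, IsSimpleOn f (I n).toSet

/-- The measurable function `f` has integral `v` over `A`, where `v` is an element of the field: `v`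
is the limit of `∑ ∫_{I n} f` over the families of disjoint intervals `I n` in `A` on which `f` is
simple, as the total length of the family tends to the measure of `A`. -/
def HasIntegral (A : Set LeviCivita) (f : LeviCivita → LeviCivita) (v : LeviCivita) : Prop :=
  IsMeasurableFun A f ∧ ∃ m, HasMeasure A m ∧
    ∀ ε : LeviCivita, 0 < ε → ∃ η : LeviCivita, 0 < η ∧
      ∀ (I : ℕ → BddInterval) (s : LeviCivita), InnerFamily A I →
        (∀ n, IsSimpleOn f (I n).toSet) → HasStrongSum (fun n => (I n).length) s → m - s < η →
        ∃ (w : ℕ → LeviCivita) (W : LeviCivita),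
          (∀ n, HasSimpleIntegral (I n) f (w n)) ∧ HasStrongSum w W ∧ |W - v| < ε

/-- `f ∈ L¹(A)`: `f` is measurable and the integral of `|f|` is defined and is not `+∞`. -/
def MemL1 (A : Set LeviCivita) (f : LeviCivita → LeviCivita) : Prop :=
  IsMeasurableFun A f ∧ ∃ v, HasIntegral A (fun x => |f x|) v

/-! ### The real-valued integral -/

/-- The supremum of the standard parts of `∫_A g`, for `g ∈ L¹(A)` with `g ≤ f` on `A`. -/
def lowerM (A : Set LeviCivita) (f : LeviCivita → LeviCivita) : EReal :=
  sSup {z | ∃ g v, MemL1 A g ∧ (∀ x ∈ A, g x ≤ f x) ∧ HasIntegral A g v ∧ z = sh v}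

/-- The infimum of the standard parts of `∫_A g`, for `g ∈ L¹(A)` with `f ≤ g` on `A`. -/
def upperM (A : Set LeviCivita) (f : LeviCivita → LeviCivita) : EReal :=
  sInf {z | ∃ g v, MemL1 A g ∧ (∀ x ∈ A, f x ≤ g x) ∧ HasIntegral A g v ∧ z = sh v}

/-- `f` is bounded on `A` (by an element of the field). -/
def IsBddOn (A : Set LeviCivita) (f : LeviCivita → LeviCivita) : Prop :=
  ∃ M : LeviCivita, ∀ x ∈ A, |f x| ≤ M

/-- The positive part of a function. -/
def posPart (f : LeviCivita → LeviCivita) : LeviCivita → LeviCivita := fun x => max (f x) 0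

/-- The negative part of a function. -/
def negPart (f : LeviCivita → LeviCivita) : LeviCivita → LeviCivita := fun x => max (-f x) 0

/-- M-integrability of a non-negative function: equality of the lower and upper values if it is
bounded, finiteness of the lower value if it is unbounded. -/
def MIntegrableNonneg (A : Set LeviCivita) (f : LeviCivita → LeviCivita) : Prop :=
  (IsBddOn A f ∧ lowerM A f = upperM A f) ∨ (¬ IsBddOn A f ∧ lowerM A f < ⊤)

open Classical in
/-- M-integrability over a measurable set `A`; the cases are: bounded, unbounded and non-negative,
unbounded and non-positive, any other unbounded function. -/
def MIntegrable (A : Set LeviCivita) (f : LeviCivita → LeviCivita) : Prop :=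
  IsMeasurableSet A ∧
  if IsBddOn A f then lowerM A f = upperM A f
  else if ∀ x ∈ A, 0 ≤ f x then lowerM A f < ⊤
  else if ∀ x ∈ A, f x ≤ 0 then MIntegrableNonneg A (negPart f)
  else MIntegrableNonneg A (posPart f) ∧ MIntegrableNonneg A (negPart f)

open Classical in
/-- The M-integral of an M-integrable function over a measurable set, in the same four cases. -/
def mIntegral (A : Set LeviCivita) (f : LeviCivita → LeviCivita) : EReal :=
  if IsBddOn A f then lowerM A f
  else if ∀ x ∈ A, 0 ≤ f x then lowerM A f
  else if ∀ x ∈ A, f x ≤ 0 then -lowerM A (negPart f)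
  else lowerM A (posPart f) - lowerM A (negPart f)

/-- `f` is M-integrable over the set of finite elements, with M-integral `v ∈ ℝ`: the M-integrals
over `[-t, t]` tend to `v` as the real number `t` tends to infinity. -/
def HasMIntegralFin (f : LeviCivita → LeviCivita) (v : ℝ) : Prop :=
  (∀ᶠ t : ℝ in atTop, MIntegrable (Set.Icc (ofReal (-t)) (ofReal t)) f) ∧
  Tendsto (fun t : ℝ => mIntegral (Set.Icc (ofReal (-t)) (ofReal t)) f) atTop (𝓝 (v : EReal))

/-! ### Dirac-like functions and the extension of order zero -/

/-- The function `δ` on the finite elements (its values elsewhere are irrelevant) is M-integrable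
and Dirac-like at `r`. -/
structure IsDiracLike (δ : LeviCivita → LeviCivita) (r : LeviCivita) : Prop where
  mem_finite : r ∈ finiteSet
  nonneg : ∀ x ∈ finiteSet, 0 ≤ δ x
  support_subset : ∃ h : LeviCivita, 0 < h ∧ IsInfinitesimal h ∧
    {x ∈ finiteSet | δ x ≠ 0} ⊆ Set.Icc (r - h) (r + h) ∧ Set.Icc (r - h) (r + h) ⊆ finiteSet
  integral_eq_one : HasMIntegralFin δ 1

/-- The extension of order zero of `f : ℝ → ℝ`: it takes the value `f r` at `r + ε`, for `r` real and
`ε` infinitesimal. (Only its values at finite elements matter.) -/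
def ext0 (f : ℝ → ℝ) (x : LeviCivita) : LeviCivita := ofReal (f (sh x).toReal)

end LeviCivita

end

namespace LeviCivita

/-! ### The ordered ring structure and real scalars -/

/-! Where `δ` is nonzero, the argument lies infinitely close to `r`, hence has standard part `r`,
and `ext0 f` takes the value `f r` there. So `δ * ext0 f` and the real multiple `f r • δ` agree at
every finite point (`IsDiracLike.mul_ext0`), and the theorem reduces to homogeneity of the
M-integral, for real scalars `c` and non-negative functions of finite integral
(`MIntegrable.ofReal_mul`).

For `c ≠ 0`, multiplication by `c` is invertible and preserves every layer of the definition: weak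
limits, simple functions, antiderivatives, integrals, `L¹`. It therefore permutes the competitors in
the lower and upper values. If `c > 0` both values scale by `c`; if `c < 0` they are also exchanged,
which is harmless in the bounded case because they agree. The case `c = 0` needs the lower value of
the zero function, obtained by a scaling argument (`lowerM_zero`) rather than from monotonicity of
the integral. -/

instance : IsStrictOrderedRing LeviCivita :=
  Function.Injective.isStrictOrderedRing
    (fun x : LeviCivita => (toLex x.1 : Lex (HahnSeries ℚ ℝ)))
    rfl rfl (fun _ _ => rfl) (fun _ _ => rfl) Iff.rfl Iff.rfl

theorem coeff_ofReal_mul (c : ℝ) (x : LeviCivita) (q : ℚ) :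
    (ofReal c * x).coeff q = c * x.coeff q :=
  HahnSeries.coeff_single_zero_mul (r := c) (x := x.1)

theorem ofReal_strictMono : StrictMono ofReal := by
  intro a b h
  refine (lt_iff _ _).2 ⟨0, fun p hp => ?_, ?_⟩
  · exact (HahnSeries.coeff_single_of_ne hp.ne).trans (HahnSeries.coeff_single_of_ne hp.ne).symm
  · have h0 (c : ℝ) : (ofReal c).coeff 0 = c := HahnSeries.coeff_single_same 0 c
    rwa [h0, h0]

theorem ofReal_le_ofReal {a b : ℝ} : ofReal a ≤ ofReal b ↔ a ≤ b := ofReal_strictMono.le_iff_le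

theorem ofReal_lt_ofReal {a b : ℝ} : ofReal a < ofReal b ↔ a < b := ofReal_strictMono.lt_iff_lt

theorem ofReal_pos {a : ℝ} : 0 < ofReal a ↔ 0 < a := by
  rw [← map_zero ofReal, ofReal_lt_ofReal]

theorem ofReal_nonneg {a : ℝ} : 0 ≤ ofReal a ↔ 0 ≤ a := by
  rw [← map_zero ofReal, ofReal_le_ofReal]

theorem ofReal_mul_ofReal_inv {c : ℝ} (hc : c ≠ 0) : ofReal c * ofReal c⁻¹ = 1 := by
  rw [← map_mul, mul_inv_cancel₀ hc, map_one]

theorem ofReal_inv_mul_cancel {c : ℝ} (hc : c ≠ 0) (x : LeviCivita) :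
    ofReal c⁻¹ * (ofReal c * x) = x := by
  rw [← mul_assoc, mul_comm (ofReal _), ofReal_mul_ofReal_inv hc, one_mul]

theorem ofReal_mul_inv_cancel {c : ℝ} (hc : c ≠ 0) (x : LeviCivita) :
    ofReal c * (ofReal c⁻¹ * x) = x := by
  rw [← mul_assoc, ofReal_mul_ofReal_inv hc, one_mul]

theorem abs_ofReal (c : ℝ) : |ofReal c| = ofReal |c| := by
  rw [abs, abs, ofReal_strictMono.monotone.map_sup, map_neg]

theorem abs_ofReal_mul (c : ℝ) (x : LeviCivita) : |ofReal c * x| = ofReal |c| * |x| := by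
  rw [abs_mul, abs_ofReal]

theorem abs_ofReal_mul_lt {c : ℝ} (hc : c ≠ 0) {x ε : LeviCivita}
    (h : |x| < ofReal |c|⁻¹ * ε) : |ofReal c * x| < ε := by
  rw [abs_ofReal_mul]
  have := mul_lt_mul_of_pos_left h (ofReal_pos.2 (abs_pos.2 hc))
  rwa [ofReal_mul_inv_cancel (abs_ne_zero.2 hc)] at this

theorem ofReal_inv_abs_mul_pos {c : ℝ} (hc : c ≠ 0) {ε : LeviCivita} (hε : 0 < ε) :
    0 < ofReal |c|⁻¹ * ε :=
  mul_pos (ofReal_pos.2 (inv_pos.2 (abs_pos.2 hc))) hε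

/-! ### The standard part -/

theorem coe_le_sh {x : LeviCivita} {a : ℝ} (h : ofReal a ≤ x) : (a : EReal) ≤ sh x :=
  le_sSup ⟨a, rfl, h⟩

theorem sh_le {x : LeviCivita} {z : EReal} (h : ∀ a : ℝ, ofReal a ≤ x → (a : EReal) ≤ z) :
    sh x ≤ z := by
  refine sSup_le ?_
  rintro _ ⟨a, rfl, ha⟩
  exact h a ha

theorem sh_neg (x : LeviCivita) : sh (-x) = -sh x := by
  refine le_antisymm (sh_le fun a ha => ?_) ?_
  · rw [EReal.le_neg]
    refine sh_le fun b hb => ?_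
    rw [← EReal.coe_neg, EReal.coe_le_coe_iff, ← ofReal_le_ofReal, map_neg]
    exact hb.trans (le_neg.1 ha)
  · refine EReal.ge_of_forall_gt_iff_ge.1 fun a ha => coe_le_sh ?_
    rw [EReal.lt_neg_comm, ← EReal.coe_neg] at ha
    by_contra h
    refine absurd (coe_le_sh (x := x) (a := -a) ?_) ha.not_ge
    rw [map_neg]
    exact (neg_lt.1 (not_le.1 h)).le

theorem coe_mul_inv_cancel {c : ℝ} (hc : c ≠ 0) (z : EReal) :
    (c : EReal) * ((c⁻¹ : ℝ) * z) = z := by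
  rw [← mul_assoc, ← EReal.coe_mul, mul_inv_cancel₀ hc, EReal.coe_one, one_mul]

theorem sh_ofReal_mul {c : ℝ} (hc : 0 < c) (x : LeviCivita) : sh (ofReal c * x) = c * sh x := by
  -- One inequality, proved for all positive scalars, suffices: applied to `c⁻¹` it gives the
  -- reverse one.
  have key : ∀ {c : ℝ}, 0 < c → ∀ x, sh (ofReal c * x) ≤ c * sh x := by
    intro c hc x
    refine sh_le fun a ha => ?_
    have h := mul_le_mul_of_nonneg_left ha (ofReal_nonneg.2 (inv_pos.2 hc).le)
    rw [ofReal_inv_mul_cancel hc.ne', ← map_mul] at h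
    have h' := mul_le_mul_of_nonneg_left (coe_le_sh h) (EReal.coe_nonneg.2 hc.le)
    rwa [EReal.coe_mul, coe_mul_inv_cancel hc.ne'] at h'
  refine le_antisymm (key hc x) ?_
  have h := key (inv_pos.2 hc) (ofReal c * x)
  rw [ofReal_inv_mul_cancel hc.ne'] at h
  have h' := mul_le_mul_of_nonneg_left h (EReal.coe_nonneg.2 hc.le)
  rwa [coe_mul_inv_cancel hc.ne'] at h'

theorem sh_zero : sh 0 = 0 := by
  refine le_antisymm (sh_le fun a ha => ?_) ?_
  · rw [← map_zero ofReal, ofReal_le_ofReal] at ha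
    exact_mod_cast ha
  · exact_mod_cast coe_le_sh (x := 0) (a := 0) (map_zero ofReal).le

/-- A real number below `r + h` is at most `r + s` for every real `s > 0`, and a real `a < r` lies
below `r - h` because `h ≤ r - a`. -/
theorem sh_eq_of_mem_Icc {r : ℝ} {h x : LeviCivita} (hh : IsInfinitesimal h)
    (hx : x ∈ Set.Icc (ofReal r - h) (ofReal r + h)) : sh x = r := by
  have hle : ∀ s : ℝ, 0 < s → h ≤ ofReal s := fun s hs => (le_abs_self h).trans (hh s hs)
  refine le_antisymm (sh_le fun a ha => ?_) (EReal.ge_of_forall_gt_iff_ge.1 fun a ha => ?_)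
  · refine EReal.coe_le_coe_iff.2 (le_of_forall_pos_le_add fun s hs => ?_)
    rw [← ofReal_le_ofReal, map_add]
    exact ha.trans (hx.2.trans (by gcongr; exact hle s hs))
  · have h1 := hle (r - a) (sub_pos.2 (EReal.coe_lt_coe_iff.1 ha))
    rw [map_sub] at h1
    exact coe_le_sh ((le_sub_comm.1 h1).trans hx.1)

/-! ### Multiplication of functions by real scalars -/

theorem WeakLim.ofReal_mul {u : ℕ → LeviCivita} {l : LeviCivita} (h : WeakLim u l) {c : ℝ}
    (hc : c ≠ 0) : WeakLim (fun k => ofReal c * u k) (ofReal c * l) := by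
  intro ε hε
  have hc' := abs_pos.2 hc
  -- In weak convergence the same `ε` bounds the coefficients and, through `ε⁻¹`, the range of
  -- exponents: the minimum handles the factor `|c|` without shrinking that range.
  have hpos : 0 < min ε (|c|⁻¹ * ε) := lt_min hε (by positivity)
  obtain ⟨n, hn⟩ := h _ hpos
  refine ⟨n, fun m hm q hq => ?_⟩
  have h1 := hn m hm q (hq.trans (inv_anti₀ hpos (min_le_left _ _)))
  rw [← mul_sub, coeff_ofReal_mul, abs_mul]
  calc |c| * |(u m - l).coeff q| < |c| * (|c|⁻¹ * ε) := by
        gcongr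
        exact h1.trans_le (min_le_right _ _)
    _ = ε := mul_inv_cancel_left₀ hc'.ne' ε

theorem HasStrongSum.ofReal_mul {u : ℕ → LeviCivita} {s : LeviCivita} (h : HasStrongSum u s)
    {c : ℝ} (hc : c ≠ 0) : HasStrongSum (fun k => ofReal c * u k) (ofReal c * s) := by
  intro ε hε
  obtain ⟨n, hn⟩ := h _ (ofReal_inv_abs_mul_pos hc hε)
  refine ⟨n, fun m hm => ?_⟩
  rw [← Finset.mul_sum, ← mul_sub]
  exact abs_ofReal_mul_lt hc (hn m hm)

theorem IsSimpleOn.ofReal_mul {f : LeviCivita → LeviCivita} {S : Set LeviCivita}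
    (h : IsSimpleOn f S) {c : ℝ} (hc : c ≠ 0) : IsSimpleOn (fun x => ofReal c * f x) S := by
  obtain ⟨a, x₀, ha⟩ := h
  refine ⟨fun n => ofReal c * a n, x₀, fun x hx => ?_⟩
  simpa only [mul_assoc, ← Finset.mul_sum] using (ha x hx).ofReal_mul hc

/-- The converse direction matters for integrals: the admissible families for `c * f` must be
admissible for `f`. This fails for `c = 0`, so the zero function is treated separately. -/
theorem isSimpleOn_ofReal_mul_iff {f : LeviCivita → LeviCivita} {S : Set LeviCivita} {c : ℝ}
    (hc : c ≠ 0) : IsSimpleOn (fun x => ofReal c * f x) S ↔ IsSimpleOn f S :=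
  ⟨fun h => by simpa only [ofReal_inv_mul_cancel hc] using h.ofReal_mul (inv_ne_zero hc),
    fun h => h.ofReal_mul hc⟩

theorem HasDerivOn.ofReal_mul {F f : LeviCivita → LeviCivita} {S : Set LeviCivita}
    (h : HasDerivOn F f S) {c : ℝ} (hc : c ≠ 0) :
    HasDerivOn (fun x => ofReal c * F x) (fun x => ofReal c * f x) S := by
  intro x hx ε hε
  obtain ⟨η, hη, H⟩ := h x hx _ (ofReal_inv_abs_mul_pos hc hε)
  refine ⟨η, hη, fun y hy hyx => ?_⟩
  have h1 := mul_le_mul_of_nonneg_left (H y hy hyx) (ofReal_nonneg.2 (abs_nonneg c))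
  rw [mul_assoc (ofReal _), ofReal_mul_inv_cancel (abs_ne_zero.2 hc), ← abs_ofReal_mul] at h1
  rwa [mul_assoc (ofReal c), ← mul_sub, ← mul_sub]

theorem HasLimWithin.ofReal_mul {F : LeviCivita → LeviCivita} {S : Set LeviCivita}
    {x l : LeviCivita} (h : HasLimWithin F S x l) {c : ℝ} (hc : c ≠ 0) :
    HasLimWithin (fun x => ofReal c * F x) S x (ofReal c * l) := by
  intro ε hε
  obtain ⟨η, hη, H⟩ := h _ (ofReal_inv_abs_mul_pos hc hε)
  refine ⟨η, hη, fun y hy hyx => ?_⟩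
  rw [← mul_sub]
  exact abs_ofReal_mul_lt hc (H y hy hyx)

theorem HasSimpleIntegral.ofReal_mul {I : BddInterval} {f : LeviCivita → LeviCivita}
    {v : LeviCivita} (h : HasSimpleIntegral I f v) {c : ℝ} (hc : c ≠ 0) :
    HasSimpleIntegral I (fun x => ofReal c * f x) (ofReal c * v) := by
  rcases h with ⟨h, rfl⟩ | ⟨h, F, la, lb, hF, hd, ha, hb, rfl⟩
  · exact Or.inl ⟨h, mul_zero _⟩
  · exact Or.inr ⟨h, _, _, _, hF.ofReal_mul hc, hd.ofReal_mul hc, ha.ofReal_mul hc,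
      hb.ofReal_mul hc, mul_sub _ _ _⟩

theorem IsMeasurableFun.ofReal_mul {A : Set LeviCivita} {f : LeviCivita → LeviCivita}
    (h : IsMeasurableFun A f) {c : ℝ} (hc : c ≠ 0) :
    IsMeasurableFun A (fun x => ofReal c * f x) := by
  obtain ⟨m, hm, H⟩ := h
  refine ⟨m, hm, fun ε hε => ?_⟩
  obtain ⟨I, s, hI, hs, hms, hf⟩ := H ε hε
  exact ⟨I, s, hI, hs, hms, fun n => (hf n).ofReal_mul hc⟩

theorem HasIntegral.ofReal_mul {A : Set LeviCivita} {f : LeviCivita → LeviCivita}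
    {v : LeviCivita} (h : HasIntegral A f v) {c : ℝ} (hc : c ≠ 0) :
    HasIntegral A (fun x => ofReal c * f x) (ofReal c * v) := by
  obtain ⟨hf, m, hm, H⟩ := h
  refine ⟨hf.ofReal_mul hc, m, hm, fun ε hε => ?_⟩
  obtain ⟨η, hη, K⟩ := H _ (ofReal_inv_abs_mul_pos hc hε)
  refine ⟨η, hη, fun I s hI hsimple hs hms => ?_⟩
  obtain ⟨w, W, hw, hW, hWv⟩ :=
    K I s hI (fun n => (isSimpleOn_ofReal_mul_iff hc).1 (hsimple n)) hs hms
  refine ⟨fun n => ofReal c * w n, ofReal c * W, fun n => (hw n).ofReal_mul hc,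
    hW.ofReal_mul hc, ?_⟩
  rw [← mul_sub]
  exact abs_ofReal_mul_lt hc hWv

theorem MemL1.ofReal_mul {A : Set LeviCivita} {f : LeviCivita → LeviCivita} (h : MemL1 A f)
    {c : ℝ} (hc : c ≠ 0) : MemL1 A (fun x => ofReal c * f x) := by
  obtain ⟨hf, v, hv⟩ := h
  refine ⟨hf.ofReal_mul hc, ofReal |c| * v, ?_⟩
  simpa only [abs_ofReal_mul] using hv.ofReal_mul (abs_ne_zero.2 hc)

theorem MemL1.neg {A : Set LeviCivita} {f : LeviCivita → LeviCivita} (h : MemL1 A f) :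
    MemL1 A (fun x => -f x) := by
  simpa using h.ofReal_mul (neg_ne_zero.2 one_ne_zero)

theorem HasIntegral.neg {A : Set LeviCivita} {f : LeviCivita → LeviCivita} {v : LeviCivita}
    (h : HasIntegral A f v) : HasIntegral A (fun x => -f x) (-v) := by
  simpa using h.ofReal_mul (neg_ne_zero.2 one_ne_zero)

/-! ### The zero function -/

theorem isSimpleOn_zero (S : Set LeviCivita) : IsSimpleOn (fun _ => 0) S :=
  ⟨fun _ => 0, 0, fun x _ ε hε => ⟨0, fun m _ q _ => by
    simpa [show coeff 0 q = 0 from rfl] using hε⟩⟩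

theorem hasSimpleIntegral_zero (I : BddInterval) : HasSimpleIntegral I (fun _ => 0) 0 := by
  rcases I.left_le_right.eq_or_lt with h | h
  · exact Or.inl ⟨h, rfl⟩
  · refine Or.inr ⟨h, fun _ => 0, 0, 0, isSimpleOn_zero _, fun x _ ε hε => ⟨1, one_pos, ?_⟩,
      fun ε hε => ⟨1, one_pos, ?_⟩, fun ε hε => ⟨1, one_pos, ?_⟩, (sub_zero 0).symm⟩
    · intro y _ _
      simpa using mul_nonneg hε.le (abs_nonneg (y - x))
    all_goals
      intro y _ _
      simpa using hε

/-- The function `f` serves only to supply interval families that exhaust the measure of `A`. -/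
theorem IsMeasurableFun.zero {A : Set LeviCivita} {f : LeviCivita → LeviCivita}
    (h : IsMeasurableFun A f) : IsMeasurableFun A (fun _ => 0) := by
  obtain ⟨m, hm, H⟩ := h
  refine ⟨m, hm, fun ε hε => ?_⟩
  obtain ⟨I, s, hI, hs, hms, -⟩ := H ε hε
  exact ⟨I, s, hI, hs, hms, fun n => isSimpleOn_zero _⟩

theorem IsMeasurableFun.hasIntegral_zero {A : Set LeviCivita} {f : LeviCivita → LeviCivita}
    (h : IsMeasurableFun A f) : HasIntegral A (fun _ => 0) 0 := by
  refine ⟨h.zero, h.choose, h.choose_spec.1, fun ε hε => ⟨1, one_pos, fun I s _ _ _ _ =>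
    ⟨fun _ => 0, 0, fun n => hasSimpleIntegral_zero _, fun ε' hε' => ⟨0, fun m _ => ?_⟩, ?_⟩⟩⟩
  · simpa using hε'
  · simpa using hε

theorem IsMeasurableFun.memL1_zero {A : Set LeviCivita} {f : LeviCivita → LeviCivita}
    (h : IsMeasurableFun A f) : MemL1 A (fun _ => 0) :=
  ⟨h.zero, 0, by simpa using h.hasIntegral_zero⟩

/-! ### The lower and upper values -/

theorem lowerM_congr {A : Set LeviCivita} {f g : LeviCivita → LeviCivita}
    (h : ∀ x ∈ A, f x = g x) : lowerM A f = lowerM A g := by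
  have (k : LeviCivita → LeviCivita) : (∀ x ∈ A, k x ≤ f x) ↔ ∀ x ∈ A, k x ≤ g x :=
    forall₂_congr fun x hx => by rw [h x hx]
  simp only [lowerM, this]

theorem upperM_congr {A : Set LeviCivita} {f g : LeviCivita → LeviCivita}
    (h : ∀ x ∈ A, f x = g x) : upperM A f = upperM A g := by
  have (k : LeviCivita → LeviCivita) : (∀ x ∈ A, f x ≤ k x) ↔ ∀ x ∈ A, g x ≤ k x :=
    forall₂_congr fun x hx => by rw [h x hx]
  simp only [upperM, this]

theorem isBddOn_congr {A : Set LeviCivita} {f g : LeviCivita → LeviCivita}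
    (h : ∀ x ∈ A, f x = g x) : IsBddOn A f ↔ IsBddOn A g :=
  exists_congr fun M => forall₂_congr fun x hx => by rw [h x hx]

theorem le_lowerM {A : Set LeviCivita} {f g : LeviCivita → LeviCivita} {v : LeviCivita}
    (hg : MemL1 A g) (hgf : ∀ x ∈ A, g x ≤ f x) (hv : HasIntegral A g v) :
    sh v ≤ lowerM A f :=
  le_sSup ⟨g, v, hg, hgf, hv, rfl⟩

theorem upperM_le {A : Set LeviCivita} {f g : LeviCivita → LeviCivita} {v : LeviCivita}
    (hg : MemL1 A g) (hgf : ∀ x ∈ A, f x ≤ g x) (hv : HasIntegral A g v) :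
    upperM A f ≤ sh v :=
  sInf_le ⟨g, v, hg, hgf, hv, rfl⟩

/-- Negation exchanges minorants and majorants in `L¹`, and commutes with the integral and with
`sh`. -/
theorem lowerM_neg (A : Set LeviCivita) (f : LeviCivita → LeviCivita) :
    lowerM A (fun x => -f x) = -upperM A f := by
  refine le_antisymm (sSup_le ?_) ?_
  · rintro _ ⟨g, v, hg, hgf, hv, rfl⟩
    rw [EReal.le_neg, ← sh_neg]
    exact upperM_le hg.neg (fun x hx => le_neg.1 (hgf x hx)) hv.neg
  · rw [EReal.neg_le]
    refine le_sInf ?_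
    rintro _ ⟨g, v, hg, hgf, hv, rfl⟩
    rw [EReal.neg_le, ← sh_neg]
    exact le_lowerM hg.neg (fun x hx => neg_le_neg (hgf x hx)) hv.neg

theorem upperM_neg (A : Set LeviCivita) (f : LeviCivita → LeviCivita) :
    upperM A (fun x => -f x) = -lowerM A f := by
  simpa using (congrArg Neg.neg (lowerM_neg A fun x => -f x)).symm

theorem lowerM_ofReal_mul (A : Set LeviCivita) (f : LeviCivita → LeviCivita) {c : ℝ}
    (hc : 0 < c) : lowerM A (fun x => ofReal c * f x) = c * lowerM A f := by
  have key : ∀ {c : ℝ}, 0 < c → ∀ f,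
      (c : EReal) * lowerM A f ≤ lowerM A (fun x => ofReal c * f x) := by
    intro c hc f
    have h : lowerM A f ≤ (c⁻¹ : ℝ) * lowerM A (fun x => ofReal c * f x) := by
      refine sSup_le ?_
      rintro _ ⟨g, v, hg, hgf, hv, rfl⟩
      have h1 := le_lowerM (hg.ofReal_mul hc.ne')
        (fun x hx => mul_le_mul_of_nonneg_left (hgf x hx) (ofReal_nonneg.2 hc.le))
        (hv.ofReal_mul hc.ne')
      have h2 := mul_le_mul_of_nonneg_left h1 (EReal.coe_nonneg.2 (inv_pos.2 hc).le)
      rwa [← sh_ofReal_mul (inv_pos.2 hc), ofReal_inv_mul_cancel hc.ne'] at h2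
    have h' := mul_le_mul_of_nonneg_left h (EReal.coe_nonneg.2 hc.le)
    rwa [coe_mul_inv_cancel hc.ne'] at h'
  refine le_antisymm ?_ (key hc f)
  have h := key (inv_pos.2 hc) (fun x => ofReal c * f x)
  simp only [ofReal_inv_mul_cancel hc.ne'] at h
  have h' := mul_le_mul_of_nonneg_left h (EReal.coe_nonneg.2 hc.le)
  rwa [coe_mul_inv_cancel hc.ne'] at h'

theorem upperM_ofReal_mul (A : Set LeviCivita) (f : LeviCivita → LeviCivita) {c : ℝ}
    (hc : 0 < c) : upperM A (fun x => ofReal c * f x) = c * upperM A f := by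
  have h := lowerM_ofReal_mul A (fun x => -f x) hc
  simp only [mul_neg, lowerM_neg] at h
  exact neg_injective h

theorem lowerM_ofReal_mul_of_neg (A : Set LeviCivita) (f : LeviCivita → LeviCivita) {c : ℝ}
    (hc : c < 0) : lowerM A (fun x => ofReal c * f x) = c * upperM A f := by
  have h := lowerM_neg A (fun x => ofReal (-c) * f x)
  rw [upperM_ofReal_mul A f (neg_pos.2 hc)] at h
  simpa using h

theorem upperM_ofReal_mul_of_neg (A : Set LeviCivita) (f : LeviCivita → LeviCivita) {c : ℝ}
    (hc : c < 0) : upperM A (fun x => ofReal c * f x) = c * lowerM A f := by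
  have h := upperM_neg A (fun x => ofReal (-c) * f x)
  rw [lowerM_ofReal_mul A f (neg_pos.2 hc)] at h
  simpa using h

theorem isBddOn_ofReal_mul_iff {A : Set LeviCivita} {f : LeviCivita → LeviCivita} {c : ℝ}
    (hc : c ≠ 0) : IsBddOn A (fun x => ofReal c * f x) ↔ IsBddOn A f := by
  have key : ∀ {c : ℝ} {f}, IsBddOn A f → IsBddOn A (fun x => ofReal c * f x) := by
    rintro c f ⟨M, hM⟩
    refine ⟨ofReal |c| * M, fun x hx => ?_⟩
    rw [abs_ofReal_mul]
    exact mul_le_mul_of_nonneg_left (hM x hx) (ofReal_nonneg.2 (abs_nonneg c))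
  refine ⟨fun h => ?_, key⟩
  simpa only [ofReal_inv_mul_cancel hc] using key (c := c⁻¹) h

/-- If some non-negative function has a finite lower value, the lower value of zero is zero. -/
theorem lowerM_zero {A : Set LeviCivita} {f : LeviCivita → LeviCivita} (hf : ∀ x ∈ A, 0 ≤ f x)
    (hbot : lowerM A f ≠ ⊥) (htop : lowerM A f ≠ ⊤) : lowerM A (fun _ => 0) = 0 := by
  refine le_antisymm (sSup_le ?_) ?_
  · rintro _ ⟨g, v, hg, hg0, hv, rfl⟩
    by_contra! hpos
    -- Since `g ≤ 0 ≤ f`, every positive multiple of `g` is still a minorant of `f`. A positive `sh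
    -- v` would then make the lower value of `f` infinite.
    have hmul : ∀ c : ℝ, 0 < c → (c : EReal) * sh v ≤ lowerM A f := fun c hc => by
      rw [← sh_ofReal_mul hc]
      refine le_lowerM (hg.ofReal_mul hc.ne') (fun x hx => ?_) (hv.ofReal_mul hc.ne')
      exact (mul_nonpos_of_nonneg_of_nonpos (ofReal_nonneg.2 hc.le) (hg0 x hx)).trans (hf x hx)
    obtain ⟨s, hs0, hsv⟩ := EReal.lt_iff_exists_real_btwn.1 hpos
    have hs : 0 < s := by exact_mod_cast hs0
    lift lowerM A f to ℝ using ⟨htop, hbot⟩ with L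
    -- This multiple makes `c * s = |L| + 1`, which exceeds `L`.
    have hc : 0 < (|L| + 1) / s := by positivity
    have h1 := (mul_le_mul_of_nonneg_left hsv.le (EReal.coe_nonneg.2 hc.le)).trans (hmul _ hc)
    rw [← EReal.coe_mul, EReal.coe_le_coe_iff, div_mul_cancel₀ _ hs.ne'] at h1
    linarith [le_abs_self L]
  -- A lower value other than `⊥` means that some minorant exists; its measurability makes zero
  -- integrable on `A`.
  · obtain ⟨_, g, v, hg, -⟩ : {z | ∃ g v, MemL1 A g ∧ (∀ x ∈ A, g x ≤ f x) ∧
        HasIntegral A g v ∧ z = sh v}.Nonempty := by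
      rw [Set.nonempty_iff_ne_empty]
      intro h
      exact hbot (by rw [lowerM, h, sSup_empty])
    rw [← sh_zero]
    exact le_lowerM hg.1.memL1_zero (fun _ _ => le_rfl) hg.1.hasIntegral_zero

/-! ### The M-integral of a real multiple of a non-negative function -/

theorem mIntegral_of_nonneg {A : Set LeviCivita} {f : LeviCivita → LeviCivita}
    (hf : ∀ x ∈ A, 0 ≤ f x) : mIntegral A f = lowerM A f := by
  rw [mIntegral, if_pos hf, ite_self]

/-- The sign of `c` decides which branch of the definition applies to `g`: an unbounded `f` with `c
< 0` lands in the non-positive branch, where `negPart g = -c * f`. -/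
theorem MIntegrable.ofReal_mul {A : Set LeviCivita} {f g : LeviCivita → LeviCivita}
    (h : MIntegrable A f) (hf : ∀ x ∈ A, 0 ≤ f x) (hbot : mIntegral A f ≠ ⊥)
    (htop : mIntegral A f ≠ ⊤) {c : ℝ} (hg : ∀ x ∈ A, g x = ofReal c * f x) :
    MIntegrable A g ∧ mIntegral A g = c * mIntegral A f := by
  obtain ⟨hA, h⟩ := h
  rw [mIntegral_of_nonneg hf] at hbot htop ⊢
  rw [if_pos hf] at h
  rcases lt_trichotomy c 0 with hc | rfl | hc
  · have hbdd : IsBddOn A g ↔ IsBddOn A f :=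
      (isBddOn_congr hg).trans (isBddOn_ofReal_mul_iff hc.ne)
    rw [MIntegrable, mIntegral, hbdd]
    by_cases hb : IsBddOn A f
    · rw [if_pos hb] at h
      rw [if_pos hb, if_pos hb, lowerM_congr hg, upperM_congr hg, lowerM_ofReal_mul_of_neg A f hc,
        upperM_ofReal_mul_of_neg A f hc, h]
      exact ⟨⟨hA, rfl⟩, rfl⟩
    · have hneg : ∀ x ∈ A, g x ≤ 0 := fun x hx => by
        rw [hg x hx]
        refine mul_nonpos_of_nonpos_of_nonneg ?_ (hf x hx)
        rw [← map_zero ofReal, ofReal_le_ofReal]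
        exact hc.le
      -- Otherwise `g` would vanish on `A` and be bounded; this rules out the non-negative branch.
      have hpos : ¬ ∀ x ∈ A, 0 ≤ g x := fun hp => hb <| hbdd.1
        ⟨0, fun x hx => by rw [le_antisymm (hneg x hx) (hp x hx), abs_zero]⟩
      have hnp : ∀ x ∈ A, negPart g x = ofReal (-c) * f x := fun x hx => by
        rw [negPart, max_eq_left (neg_nonneg.2 (hneg x hx)), hg x hx, map_neg, neg_mul]
      have hc' := neg_pos.2 hc
      have hlow : lowerM A (negPart g) = (-c : ℝ) * lowerM A f := by
        rw [lowerM_congr hnp, lowerM_ofReal_mul A f hc']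
      rw [if_neg hb, if_neg hb, if_neg hpos, if_neg hpos, if_pos hneg, if_pos hneg, hlow]
      refine ⟨⟨hA, Or.inr ⟨?_, ?_⟩⟩, ?_⟩
      · rwa [isBddOn_congr hnp, isBddOn_ofReal_mul_iff hc'.ne']
      · rw [hlow]
        lift lowerM A f to ℝ using ⟨htop, hbot⟩ with L
        rw [← EReal.coe_mul]
        exact EReal.coe_lt_top _
      · simp
  · have hg0 : ∀ x ∈ A, g x = 0 := fun x hx => by rw [hg x hx, map_zero, zero_mul]
    have hb : IsBddOn A g := ⟨0, fun x hx => by rw [hg0 x hx, abs_zero]⟩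
    have hl : lowerM A g = 0 := (lowerM_congr hg0).trans (lowerM_zero hf hbot htop)
    -- The upper value follows from the lower one by negation, as `-0 = 0`.
    have hu : upperM A g = 0 := by
      have := upperM_neg A (fun _ => 0)
      rw [lowerM_zero hf hbot htop] at this
      rw [upperM_congr hg0]
      simpa using this
    rw [MIntegrable, mIntegral, if_pos hb, if_pos hb, hl, hu]
    exact ⟨⟨hA, rfl⟩, by simp⟩
  · have hbdd : IsBddOn A g ↔ IsBddOn A f :=
      (isBddOn_congr hg).trans (isBddOn_ofReal_mul_iff hc.ne')
    have hpos : ∀ x ∈ A, 0 ≤ g x := fun x hx => by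
      rw [hg x hx]
      exact mul_nonneg (ofReal_nonneg.2 hc.le) (hf x hx)
    rw [mIntegral_of_nonneg hpos, MIntegrable, if_pos hpos, hbdd, lowerM_congr hg,
      upperM_congr hg, lowerM_ofReal_mul A f hc, upperM_ofReal_mul A f hc]
    refine ⟨⟨hA, ?_⟩, rfl⟩
    split_ifs at h ⊢
    · rw [h]
    · lift lowerM A f to ℝ using ⟨htop, hbot⟩ with L
      rw [← EReal.coe_mul]
      exact EReal.coe_lt_top _

theorem HasMIntegralFin.ofReal_mul {f g : LeviCivita → LeviCivita} {v : ℝ}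
    (h : HasMIntegralFin f v) (hf : ∀ x ∈ finiteSet, 0 ≤ f x) {c : ℝ}
    (hg : ∀ x ∈ finiteSet, g x = ofReal c * f x) : HasMIntegralFin g (c * v) := by
  obtain ⟨hint, hlim⟩ := h
  have hsub : ∀ t : ℝ, Set.Icc (ofReal (-t)) (ofReal t) ⊆ finiteSet := fun t x hx => by
    -- The extra `1` provides the strict inequality in `finiteSet`.
    refine ⟨t + 1, (abs_le.2 ⟨?_, hx.2⟩).trans_lt (ofReal_lt_ofReal.2 (lt_add_one t))⟩
    rw [← map_neg]
    exact hx.1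
  have key : ∀ᶠ t : ℝ in atTop, MIntegrable (Set.Icc (ofReal (-t)) (ofReal t)) g ∧
      mIntegral (Set.Icc (ofReal (-t)) (ofReal t)) g =
        c * mIntegral (Set.Icc (ofReal (-t)) (ofReal t)) f := by
    -- The limit is real, so the integrals over `[-t, t]` are eventually finite, as homogeneity
    -- requires.
    filter_upwards [hint, hlim.eventually_ne (EReal.coe_ne_bot v),
      hlim.eventually_ne (EReal.coe_ne_top v)] with t ht hbot htop
    exact ht.ofReal_mul (fun x hx => hf x (hsub t hx)) hbot htop (fun x hx => hg x (hsub t hx))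
  refine ⟨key.mono fun t ht => ht.1, ?_⟩
  rw [EReal.coe_mul]
  refine Tendsto.congr' (key.mono fun t ht => ht.2.symm) ?_
  exact EReal.Tendsto.const_mul hlim (Or.inl (EReal.coe_ne_bot c)) (Or.inl (EReal.coe_ne_top c))

theorem IsDiracLike.mul_ext0 {r : ℝ} {δ : LeviCivita → LeviCivita}
    (hδ : IsDiracLike δ (ofReal r)) (f : ℝ → ℝ) {x : LeviCivita} (hx : x ∈ finiteSet) :
    δ x * ext0 f x = ofReal (f r) * δ x := by
  obtain ⟨h, -, hinf, hsupp, -⟩ := hδ.support_subset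
  by_cases h0 : δ x = 0
  · rw [h0, zero_mul, mul_zero]
  · rw [ext0, sh_eq_of_mem_Icc hinf (hsupp ⟨hx, h0⟩), EReal.toReal_coe, mul_comm]

end LeviCivita

theorem mainTheorem10 (r : ℝ) (δ : LeviCivita → LeviCivita)
    (hδ : LeviCivita.IsDiracLike δ (LeviCivita.ofReal r))
    (f : ℝ → ℝ) (hf : Continuous f) :
    LeviCivita.HasMIntegralFin (fun x => δ x * LeviCivita.ext0 f x) (f r) := by
  simpa using hδ.integral_eq_one.ofReal_mul hδ.nonneg fun x hx => hδ.mul_ext0 f hx
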